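/- For a Lipschitz function $u:[0,2\pi]\to\mathbb{R}$ with $0<\|u\|_{L^\infty(0,2\pi)}<1/24$ put $$ J(u)=\frac{\pi}{2}\,\frac{\displaystyle\int_0^{2\pi}\left[\sqrt{(1+u)^2+u'(\theta)^2}-1\right]d\theta}{\left[\frac12\displaystyle\int_0^{2\pi}\left|(1+u)^2-1\right|d\theta\right]^2}. $$ For $0<\varepsilon<1/24$ let $m_\varepsilon$ be the infimum of $J(u)$ over all Lipschitz functions $u:[0,2\pi]\to\mathbb{R}$ with $\|u\|_{L^\infty(0,2\pi)}=\varepsilon$ such that $$ \frac1{2\pi}\int_0^{2\pi}(1+u)^2\,d\theta=1,\qquad \int_0^{2\pi}\cos\theta\,(1+u)^3\,d\theta=0=\int_0^{2\pi}\sin\theta\,(1+u)^3\,d\theta,\qquad u(0)=u(2\pi). $$ Let $$ m=\inf\ \frac{\displaystyle\int_0^{2\pi}\left[(u')^2-u^2\right]d\theta}{\left[\displaystyle\int_0^{2\pi}|u|\,d\theta\right]^2}, $$ the infimum being over all nonzero $u\in H^1(0,2\pi)$ with $\int_0^{2\pi}u\,d\theta=\int_0^{2\pi}u\cos\theta\,d\theta=\int_0^{2\pi}u\sin\theta\,d\theta=0$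 and $u(0)=u(2\pi)$. Then $$ \liminf_{\varepsilon\to0^+}m_\varepsilon\ \ge\ \frac{\pi}{4}\,m . $$ -/

import Mathlib

open MeasureTheory Set Filter Topology
open scoped Real ContDiff

noncomputable section

namespace BarycentricAsymmetry

/-- The functional `J(u)`: isoperimetric deficit over squared barycentric asymmetry, in polar
coordinates. It is used for Lipschitz `u` only, for which `deriv u` exists almost everywhere on
`(0, 2π)`. -/
def J (u : ℝ → ℝ) : ℝ :=
  π / 2 * (∫ θ in (0 : ℝ)..(2 * π), (√((1 + u θ) ^ 2 + deriv u θ ^ 2) - 1)) /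
    (1 / 2 * ∫ θ in (0 : ℝ)..(2 * π), |(1 + u θ) ^ 2 - 1|) ^ 2

/-- Competitors for `m_ε`: Lipschitz functions on `[0, 2π]` with `‖u‖_{L^∞(0, 2π)} = ε` that
satisfy the area, barycentre and periodicity constraints. -/
structure Admissible (ε : ℝ) (u : ℝ → ℝ) : Prop where
  lipschitz : ∃ K, LipschitzOnWith K u (Icc 0 (2 * π))
  norm_eq : eLpNorm u ⊤ (volume.restrict (Ioo 0 (2 * π))) = ENNReal.ofReal ε
  area : 1 / (2 * π) * ∫ θ in (0 : ℝ)..(2 * π), (1 + u θ) ^ 2 = 1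
  barycentre_cos : ∫ θ in (0 : ℝ)..(2 * π), Real.cos θ * (1 + u θ) ^ 3 = 0
  barycentre_sin : ∫ θ in (0 : ℝ)..(2 * π), Real.sin θ * (1 + u θ) ^ 3 = 0
  periodic : u 0 = u (2 * π)

/-- `m_ε`, the infimum of `J` over the competitors, taken in the extended reals. -/
def mEps (ε : ℝ) : EReal :=
  sInf {r : EReal | ∃ u : ℝ → ℝ, Admissible ε u ∧ r = (J u : EReal)}

/-- `g` is a weak derivative of `u` on the open interval `(a, b)`. -/
def IsWeakDeriv (a b : ℝ) (u g : ℝ → ℝ) : Prop :=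
  LocallyIntegrableOn u (Ioo a b) ∧ LocallyIntegrableOn g (Ioo a b) ∧
    ∀ φ : ℝ → ℝ, ContDiff ℝ ∞ φ → HasCompactSupport φ → tsupport φ ⊆ Ioo a b →
      ∫ x in Ioo a b, u x * deriv φ x = -∫ x in Ioo a b, g x * φ x

/-- `u` is (the representative, continuous on `[a, b]`, of) an element of `H¹(a, b)`, and `g` is
its weak derivative. The continuous representative is what gives the boundary values of `u` their
meaning. -/
structure IsH1 (a b : ℝ) (u g : ℝ → ℝ) : Prop where
  continuousOn : ContinuousOn u (Icc a b)
  memLp : MemLp u 2 (volume.restrict (Ioo a b))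
  memLp_deriv : MemLp g 2 (volume.restrict (Ioo a b))
  weakDeriv : IsWeakDeriv a b u g

/-- Competitors `u` for `m`, with their weak derivative `g`: nonzero `H¹(0, 2π)` functions
that satisfy the linear constraints. -/
structure LinAdmissible (u g : ℝ → ℝ) : Prop where
  isH1 : IsH1 0 (2 * π) u g
  ne_zero : ∃ θ ∈ Icc 0 (2 * π), u θ ≠ 0
  orth_one : ∫ θ in (0 : ℝ)..(2 * π), u θ = 0
  orth_cos : ∫ θ in (0 : ℝ)..(2 * π), u θ * Real.cos θ = 0
  orth_sin : ∫ θ in (0 : ℝ)..(2 * π), Real.sin θ * u θ = 0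
  periodic : u 0 = u (2 * π)

/-- The linearized quotient; `g` stands for `u'`. -/
def linQuotient (u g : ℝ → ℝ) : ℝ :=
  (∫ θ in (0 : ℝ)..(2 * π), (g θ ^ 2 - u θ ^ 2)) / (∫ θ in (0 : ℝ)..(2 * π), |u θ|) ^ 2

/-- `m`, the infimum of the linearized quotient, taken in the extended reals. -/
def mLin : EReal :=
  sInf {r : EReal | ∃ u g : ℝ → ℝ, LinAdmissible u g ∧ r = (linQuotient u g : EReal)}

end BarycentricAsymmetry

end

noncomputable section

namespace BarycentricAsymmetry

/-! Fix a real `M` below every linearized quotient and `C < π / 4 * M`; the claim is that `J u ≥ C`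
for all competitors once `ε` is small, uniformly in `u`. The area constraint turns the deficit into
`E - ½∫u²`, where `E` is the `excess`. If `J u < C`, then `E = O(ε²)`.

No bound on the slope is available beyond this, so the slope is cut at a small threshold `δ`. Its
flat part has energy at most `(2 + 2ε + δ) E`, with the sharp factor `2` in the limit; its steep
part is `O(ε²)` in `L¹`, with a constant depending on `δ`. Dropping the steep part, restoring
periodicity and subtracting the mean and first harmonics (themselves `O(ε²)` by the constraints)
moves `u` uniformly by `O(ε²)` and gives a competitor for `m` (`exists_linAdmissible_near`). Its
quotient bound passes back to `u` with error `Aδε² + Rε³` (`le_deficit`).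

This error is harmless because `u` cannot concentrate: `∫|u|` is at least a constant times `ε`
(`le_integral_abs`), so the denominator of `J` is of order `ε²`. Choosing `δ` first and then `ε`
gives a contradiction. -/

/-! ### Primitives of bounded functions. -/

lemma intervalIntegrable_of_bound {f : ℝ → ℝ} (hf : Measurable f) {C : ℝ}
    (hC : ∀ x, |f x| ≤ C) (a b : ℝ) : IntervalIntegrable f volume a b :=
  (intervalIntegrable_const (c := C)).mono_fun hf.aestronglyMeasurable
    (Eventually.of_forall fun x => (hC x).trans (le_abs_self C))

lemma lipschitzWith_primitive {g : ℝ → ℝ} (hg : Measurable g) {C : ℝ} (hC : ∀ x, |g x| ≤ C)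
    (c : ℝ) : LipschitzWith C.toNNReal (fun x => c + ∫ t in (0 : ℝ)..x, g t) := by
  have h0 : 0 ≤ C := (abs_nonneg _).trans (hC 0)
  refine LipschitzWith.of_dist_le_mul fun x y => ?_
  rw [Real.dist_eq, Real.dist_eq, Real.coe_toNNReal _ h0, add_sub_add_left_eq_sub,
    intervalIntegral.integral_interval_sub_left (intervalIntegrable_of_bound hg hC _ _)
      (intervalIntegrable_of_bound hg hC _ _)]
  refine intervalIntegral.norm_integral_le_of_norm_le_const (f := g) fun t _ => ?_
  exact hC t

/-- A function with a bounded weak derivative belongs to `H¹`. -/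
lemma isH1_primitive {g : ℝ → ℝ} (hg : Measurable g) {C : ℝ} (hC : ∀ x, |g x| ≤ C)
    (c : ℝ) {a b : ℝ} (hab : a ≤ b) :
    IsH1 a b (fun x => c + ∫ t in (0 : ℝ)..x, g t) g := by
  set w : ℝ → ℝ := fun x => c + ∫ t in (0 : ℝ)..x, g t with hw
  have hL := lipschitzWith_primitive hg hC c
  have hcont : Continuous w := hL.continuous
  have hgint : ∀ x y, IntervalIntegrable g volume x y := intervalIntegrable_of_bound hg hC
  have hgloc : LocallyIntegrable g volume := by
    intro x
    refine ⟨Ioc (x - 1) (x + 1), Ioc_mem_nhds (by linarith) (by linarith), ?_⟩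
    exact (intervalIntegrable_iff_integrableOn_Ioc_of_le (by linarith)).1 (hgint _ _)
  obtain ⟨B, hB⟩ := isCompact_Icc.exists_bound_of_continuousOn (hcont.continuousOn (s := Icc a b))
  have hderiv : ∀ᵐ x, HasDerivAt w (g x) x := by
    filter_upwards [LocallyIntegrable.ae_hasDerivAt_integral hgloc] with x hx
    exact (hx 0).const_add c
  refine ⟨hcont.continuousOn, ?_, ?_, hcont.locallyIntegrable.locallyIntegrableOn _,
    hgloc.locallyIntegrableOn _, ?_⟩
  · refine MemLp.of_bound hcont.aestronglyMeasurable B ?_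
    exact (ae_restrict_mem measurableSet_Ioo).mono fun x hx => hB x (Ioo_subset_Icc_self hx)
  · exact MemLp.of_bound hg.aestronglyMeasurable C (Eventually.of_forall hC)
  · intro φ hφ _ hsupp
    have hφa : φ a = 0 := by
      by_contra h
      exact lt_irrefl _ (hsupp (subset_tsupport φ h)).1
    have hφb : φ b = 0 := by
      by_contra h
      exact lt_irrefl _ (hsupp (subset_tsupport φ h)).2
    -- Integration by parts for absolutely continuous functions; `φ` vanishes at both ends, so no
    -- boundary term survives.
    have h1 := (hL.lipschitzOnWith (s := uIcc a b)).absolutelyContinuousOnInterval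
    have h2 := (hφ.of_le (m := 1) (by simp)).contDiffOn (s := uIcc a b) |>.absolutelyContinuousOnInterval
    have h3 := h1.integral_mul_deriv_eq_deriv_mul h2
    rw [hφa, hφb, mul_zero, mul_zero, sub_zero, zero_sub] at h3
    rw [← integral_Ioc_eq_integral_Ioo, ← integral_Ioc_eq_integral_Ioo,
      ← intervalIntegral.integral_of_le hab, ← intervalIntegral.integral_of_le hab, h3]
    congr 1
    refine intervalIntegral.integral_congr_ae ?_
    filter_upwards [hderiv] with x hx _
    rw [hx.deriv]

/-! ### Pointwise bounds on the length density. -/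

/-- The chord-length density controls the square of small slopes. -/
lemma sq_le_mul_sqrt_sub {a p δ : ℝ} (ha : 0 ≤ a) (hp : |p| ≤ δ) :
    p ^ 2 ≤ (2 * a + δ) * (√(a ^ 2 + p ^ 2) - a) := by
  have h0 : 0 ≤ a ^ 2 + p ^ 2 := by positivity
  have hs := Real.sq_sqrt h0
  have h1 : a ≤ √(a ^ 2 + p ^ 2) := Real.le_sqrt_of_sq_le (by nlinarith)
  have h2 : √(a ^ 2 + p ^ 2) ≤ a + |p| := by
    rw [Real.sqrt_le_left (by positivity)]
    nlinarith [sq_abs p, mul_nonneg ha (abs_nonneg p)]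
  -- `p ^ 2 = (√ - a) * (√ + a)`, and the second factor is at most `2 * a + |p|`.
  nlinarith

lemma le_sqrt_sq_add_sq {a : ℝ} (p : ℝ) : a ≤ √(a ^ 2 + p ^ 2) :=
  Real.le_sqrt_of_sq_le (by nlinarith)

/-- The chord-length density controls large slopes linearly. -/
lemma mul_abs_le_sqrt_sub {a p t : ℝ} (ha : 0 ≤ a) (ha' : 2 * a ≤ 3) (ht : 0 < t) (ht' : t ≤ 1)
    (hp : t ≤ |p|) : t * |p| ≤ 4 * (√(a ^ 2 + p ^ 2) - a) := by
  have h1 := sq_le_mul_sqrt_sub ha (le_refl |p|)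
  have h2 := le_sqrt_sq_add_sq (a := a) p
  have h3 : |p| ^ 2 ≤ (3 + |p|) * (√(a ^ 2 + p ^ 2) - a) := by
    rw [sq_abs]; nlinarith
  have h4 : t * |p| * (3 + |p|) ≤ 4 * |p| ^ 2 := by nlinarith [abs_nonneg p]
  have h5 : 0 < 3 + |p| := by positivity
  by_contra! h
  nlinarith

/-- Slopes below `t` are absorbed by the first term, larger ones by the second. The threshold stays
free so that the two can be balanced after integration. -/
lemma abs_le_add_sqrt_sub {a t : ℝ} (p : ℝ) (ha : 0 ≤ a) (ha' : 2 * a ≤ 3) (ht : 0 < t)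
    (ht' : t ≤ 1) : |p| ≤ t + 4 / t * (√(a ^ 2 + p ^ 2) - a) := by
  have h2 := le_sqrt_sq_add_sq (a := a) p
  have h3 : 0 ≤ 4 / t * (√(a ^ 2 + p ^ 2) - a) := mul_nonneg (by positivity) (by linarith)
  rcases le_total |p| t with h | h
  · linarith
  · have h1 := mul_abs_le_sqrt_sub ha ha' ht ht' h
    have : |p| ≤ 4 / t * (√(a ^ 2 + p ^ 2) - a) := by
      rw [div_mul_eq_mul_div, le_div_iff₀ ht]; linarith
    linarith

/-! ### Orthogonal projection off the first harmonics. -/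

/-- Removing the first harmonics of a periodic primitive gives a competitor for `m`. -/
lemma linAdmissible_sub_harmonics {g : ℝ → ℝ} (hg : Measurable g) {C : ℝ} (hC : ∀ x, |g x| ≤ C)
    {v : ℝ → ℝ} (hv : ∀ x, v x = v 0 + ∫ t in (0 : ℝ)..x, g t) (hper : v 0 = v (2 * π))
    {a b c : ℝ} (ha : 2 * π * a = ∫ θ in (0 : ℝ)..(2 * π), v θ)
    (hb : π * b = ∫ θ in (0 : ℝ)..(2 * π), v θ * Real.cos θ)
    (hc : π * c = ∫ θ in (0 : ℝ)..(2 * π), v θ * Real.sin θ)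
    (hne : ∃ θ ∈ Icc 0 (2 * π), v θ - a - b * Real.cos θ - c * Real.sin θ ≠ 0) :
    LinAdmissible (fun θ => v θ - a - b * Real.cos θ - c * Real.sin θ)
      (fun θ => g θ + b * Real.sin θ - c * Real.cos θ) := by
  have hvc : Continuous v := by
    rw [funext hv]; exact (lipschitzWith_primitive hg hC _).continuous
  have hII : ∀ {f : ℝ → ℝ}, Continuous f → IntervalIntegrable f volume 0 (2 * π) :=
    fun h => h.intervalIntegrable _ _
  have e1 : ∫ θ in (0 : ℝ)..(2 * π), Real.cos θ = 0 := by simp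
  have e2 : ∫ θ in (0 : ℝ)..(2 * π), Real.sin θ = 0 := by simp
  have e3 : ∫ θ in (0 : ℝ)..(2 * π), Real.cos θ ^ 2 = π := by
    rw [integral_cos_sq]; simp
  have e4 : ∫ θ in (0 : ℝ)..(2 * π), Real.sin θ ^ 2 = π := by
    rw [integral_sin_sq]; simp
  have e5 : ∫ θ in (0 : ℝ)..(2 * π), Real.sin θ * Real.cos θ = 0 := by
    rw [integral_sin_mul_cos₁]; simp
  refine ⟨?_, hne, ?_, ?_, ?_, by simp [hper]⟩
  · have key : (fun θ => v θ - a - b * Real.cos θ - c * Real.sin θ) = fun x =>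
        (v 0 - a - b) + ∫ t in (0 : ℝ)..x, (g t + b * Real.sin t - c * Real.cos t) := by
      funext x
      have i1 := intervalIntegrable_of_bound hg hC 0 x
      have i2 : IntervalIntegrable (fun t => b * Real.sin t) volume 0 x :=
        Continuous.intervalIntegrable (by fun_prop) _ _
      have i3 : IntervalIntegrable (fun t => c * Real.cos t) volume 0 x :=
        Continuous.intervalIntegrable (by fun_prop) _ _
      rw [intervalIntegral.integral_sub (i1.add i2) i3, intervalIntegral.integral_add i1 i2,
        intervalIntegral.integral_const_mul, intervalIntegral.integral_const_mul, integral_sin,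
        integral_cos, hv x, Real.cos_zero, Real.sin_zero]
      ring
    rw [key]
    refine isH1_primitive (C := C + |b| + |c|) (by fun_prop) (fun x => ?_) _ (by positivity)
    calc |g x + b * Real.sin x - c * Real.cos x|
        ≤ |g x| + |b * Real.sin x| + |c * Real.cos x| :=
          (abs_sub _ _).trans (add_le_add_left (abs_add_le _ _) _)
      _ ≤ C + |b| + |c| := by
          rw [abs_mul, abs_mul]
          have := hC x
          have := mul_le_of_le_one_right (abs_nonneg b) (Real.abs_sin_le_one x)
          have := mul_le_of_le_one_right (abs_nonneg c) (Real.abs_cos_le_one x)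
          linarith
  · rw [intervalIntegral.integral_sub (hII (by fun_prop)) (hII (by fun_prop)),
      intervalIntegral.integral_sub (hII (by fun_prop)) (hII (by fun_prop)),
      intervalIntegral.integral_sub (hII (by fun_prop)) (hII (by fun_prop)),
      intervalIntegral.integral_const_mul, intervalIntegral.integral_const_mul, e1, e2, ← ha]
    simp
  · have : ∀ θ, (v θ - a - b * Real.cos θ - c * Real.sin θ) * Real.cos θ =
        v θ * Real.cos θ - a * Real.cos θ - b * Real.cos θ ^ 2
          - c * (Real.sin θ * Real.cos θ) := fun θ => by ring
    simp_rw [this]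
    rw [intervalIntegral.integral_sub (hII (by fun_prop)) (hII (by fun_prop)),
      intervalIntegral.integral_sub (hII (by fun_prop)) (hII (by fun_prop)),
      intervalIntegral.integral_sub (hII (by fun_prop)) (hII (by fun_prop)),
      intervalIntegral.integral_const_mul, intervalIntegral.integral_const_mul,
      intervalIntegral.integral_const_mul, e1, e3, e5, ← hb]
    ring
  · have : ∀ θ, Real.sin θ * (v θ - a - b * Real.cos θ - c * Real.sin θ) =
        v θ * Real.sin θ - a * Real.sin θ - b * (Real.sin θ * Real.cos θ)
          - c * Real.sin θ ^ 2 := fun θ => by ring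
    simp_rw [this]
    rw [intervalIntegral.integral_sub (hII (by fun_prop)) (hII (by fun_prop)),
      intervalIntegral.integral_sub (hII (by fun_prop)) (hII (by fun_prop)),
      intervalIntegral.integral_sub (hII (by fun_prop)) (hII (by fun_prop)),
      intervalIntegral.integral_const_mul, intervalIntegral.integral_const_mul,
      intervalIntegral.integral_const_mul, e2, e4, e5, ← hc]
    ring

/-! ### Profiles: consequences of the constraints and non-concentration. -/

/-- Small periodic Lipschitz profiles `u` with derivative `p`, bounded on the whole line, that
satisfy the nonlinear constraints. -/
structure IsProfile (ε K : ℝ) (u p : ℝ → ℝ) : Prop where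
  pos : 0 < ε
  lt : ε < 1 / 24
  cont : Continuous u
  meas : Measurable p
  bound : ∀ x, |u x| ≤ ε
  bound_deriv : ∀ x, |p x| ≤ K
  primitive : ∀ a b, ∫ t in a..b, p t = u b - u a
  periodic : u 0 = u (2 * π)
  area : ∫ θ in (0 : ℝ)..(2 * π), (1 + u θ) ^ 2 = 2 * π
  barycentre_cos : ∫ θ in (0 : ℝ)..(2 * π), Real.cos θ * (1 + u θ) ^ 3 = 0
  barycentre_sin : ∫ θ in (0 : ℝ)..(2 * π), Real.sin θ * (1 + u θ) ^ 3 = 0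
  attained : ∃ x ∈ Icc 0 (2 * π), |u x| = ε

/-- The part of the perimeter that is due to the slope. -/
def excess (u p : ℝ → ℝ) (a b : ℝ) : ℝ :=
  ∫ θ in a..b, (√((1 + u θ) ^ 2 + p θ ^ 2) - (1 + u θ))

lemma abs_intervalIntegral_le {f : ℝ → ℝ} {a b C : ℝ} (hab : a ≤ b)
    (h : ∀ x ∈ Icc a b, |f x| ≤ C) : |∫ x in a..b, f x| ≤ C * (b - a) := by
  have := intervalIntegral.norm_integral_le_of_norm_le_const (a := a) (b := b) (f := f) (C := C)
    fun x hx => by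
      rw [uIoc_of_le hab] at hx
      exact h x (Ioc_subset_Icc_self hx)
  rwa [abs_of_nonneg (sub_nonneg.2 hab)] at this

lemma abs_sqrt_sub_le {a : ℝ} (p : ℝ) (ha : 0 ≤ a) : |√(a ^ 2 + p ^ 2) - a| ≤ |p| := by
  rw [abs_of_nonneg (sub_nonneg.2 (le_sqrt_sq_add_sq p)), sub_le_iff_le_add,
    Real.sqrt_le_left (by positivity)]
  nlinarith [sq_abs p, mul_nonneg ha (abs_nonneg p)]

namespace IsProfile

variable {ε K : ℝ} {u p : ℝ → ℝ}

lemma one_add_nonneg (h : IsProfile ε K u p) (x : ℝ) : 0 ≤ 1 + u x := by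
  have := (abs_le.1 (h.bound x)).1
  linarith [h.lt]

lemma two_mul_one_add_le (h : IsProfile ε K u p) (x : ℝ) : 2 * (1 + u x) ≤ 3 := by
  have := (abs_le.1 (h.bound x)).2
  linarith [h.lt]

lemma intervalIntegrable_deriv (h : IsProfile ε K u p) (a b : ℝ) :
    IntervalIntegrable p volume a b :=
  intervalIntegrable_of_bound h.meas h.bound_deriv a b

lemma intervalIntegrable_excess (h : IsProfile ε K u p) (a b : ℝ) :
    IntervalIntegrable (fun θ => √((1 + u θ) ^ 2 + p θ ^ 2) - (1 + u θ)) volume a b := by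
  have := h.meas
  have := h.cont.measurable
  exact intervalIntegrable_of_bound (C := K) (by fun_prop)
    (fun x => (abs_sqrt_sub_le _ (h.one_add_nonneg x)).trans (h.bound_deriv x)) a b

lemma excess_density_nonneg (_ : IsProfile ε K u p) (x : ℝ) :
    0 ≤ √((1 + u x) ^ 2 + p x ^ 2) - (1 + u x) :=
  sub_nonneg.2 (le_sqrt_sq_add_sq _)

lemma excess_mono (h : IsProfile ε K u p) {a b c d : ℝ} (hca : c ≤ a) (hab : a ≤ b)
    (hbd : b ≤ d) : excess u p a b ≤ excess u p c d :=
  intervalIntegral.integral_mono_interval hca hab hbd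
    (Eventually.of_forall h.excess_density_nonneg) (h.intervalIntegrable_excess c d)

/-- Expanding the square in the area constraint shows that the mean of `u` is of second order. -/
lemma integral_eq (h : IsProfile ε K u p) :
    ∫ θ in (0 : ℝ)..(2 * π), u θ = -(1 / 2 * ∫ θ in (0 : ℝ)..(2 * π), u θ ^ 2) := by
  have hc := h.cont
  have h1 := h.area
  have : ∀ θ, (1 + u θ) ^ 2 = 1 + 2 * u θ + u θ ^ 2 := fun θ => by ring
  simp_rw [this] at h1
  rw [intervalIntegral.integral_add (Continuous.intervalIntegrable (by fun_prop) _ _)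
      (Continuous.intervalIntegrable (by fun_prop) _ _),
    intervalIntegral.integral_add (Continuous.intervalIntegrable (by fun_prop) _ _)
      (Continuous.intervalIntegrable (by fun_prop) _ _),
    intervalIntegral.integral_const_mul] at h1
  simp at h1
  linarith

/-- The linear term `∫u` of the length is traded for `-½∫u²`, which is the source of the negative
term in the linearized quotient. -/
lemma deficit_eq (h : IsProfile ε K u p) :
    ∫ θ in (0 : ℝ)..(2 * π), (√((1 + u θ) ^ 2 + p θ ^ 2) - 1) =
      excess u p 0 (2 * π) - 1 / 2 * ∫ θ in (0 : ℝ)..(2 * π), u θ ^ 2 := by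
  rw [sub_eq_add_neg, ← h.integral_eq, excess,
    ← intervalIntegral.integral_add (h.intervalIntegrable_excess _ _)
      (h.cont.intervalIntegrable _ _)]
  congr 1
  ext θ
  ring

lemma sq_bound (h : IsProfile ε K u p) (x : ℝ) : u x ^ 2 ≤ ε ^ 2 :=
  sq_le_sq' (abs_le.1 (h.bound x)).1 (abs_le.1 (h.bound x)).2

lemma integral_sq_le (h : IsProfile ε K u p) :
    ∫ θ in (0 : ℝ)..(2 * π), u θ ^ 2 ≤ 2 * π * ε ^ 2 := by
  have := abs_intervalIntegral_le (f := fun θ => u θ ^ 2) (C := ε ^ 2) Real.two_pi_pos.le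
    fun x _ => by rw [abs_of_nonneg (sq_nonneg _)]; exact h.sq_bound x
  linarith [le_abs_self (∫ θ in (0 : ℝ)..(2 * π), u θ ^ 2)]

lemma integral_sq_nonneg (_ : IsProfile ε K u p) :
    0 ≤ ∫ θ in (0 : ℝ)..(2 * π), u θ ^ 2 :=
  intervalIntegral.integral_nonneg Real.two_pi_pos.le fun _ _ => sq_nonneg _

/-- A nonlinear barycentre constraint makes the first harmonic of `u` quadratically small. -/
lemma abs_integral_mul_le (h : IsProfile ε K u p) {f : ℝ → ℝ} (hf : Continuous f)
    (hf1 : ∀ x, |f x| ≤ 1) (hf0 : ∫ θ in (0 : ℝ)..(2 * π), f θ = 0)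
    (hfu : ∫ θ in (0 : ℝ)..(2 * π), f θ * (1 + u θ) ^ 3 = 0) :
    |∫ θ in (0 : ℝ)..(2 * π), u θ * f θ| ≤ 4 * π * ε ^ 2 := by
  have hc := h.cont
  have e : ∀ θ, f θ * (1 + u θ) ^ 3 =
      f θ + 3 * (u θ * f θ) + 3 * (f θ * (u θ ^ 2 + u θ ^ 3 / 3)) := fun θ => by ring
  simp_rw [e] at hfu
  rw [intervalIntegral.integral_add (Continuous.intervalIntegrable (by fun_prop) _ _)
      (Continuous.intervalIntegrable (by fun_prop) _ _),
    intervalIntegral.integral_add (Continuous.intervalIntegrable (by fun_prop) _ _)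
      (Continuous.intervalIntegrable (by fun_prop) _ _),
    intervalIntegral.integral_const_mul, intervalIntegral.integral_const_mul, hf0] at hfu
  have h2 : |∫ θ in (0 : ℝ)..(2 * π), f θ * (u θ ^ 2 + u θ ^ 3 / 3)| ≤
      2 * ε ^ 2 * (2 * π - 0) := by
    refine abs_intervalIntegral_le Real.two_pi_pos.le fun x _ => ?_
    have h3 := h.sq_bound x
    have h4 := abs_le.1 (h.bound x)
    have h5 : |u x ^ 2 + u x ^ 3 / 3| ≤ 2 * ε ^ 2 := by
      have : u x ^ 2 + u x ^ 3 / 3 = u x ^ 2 * (1 + u x / 3) := by ring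
      have h6 : 0 ≤ 1 + u x / 3 := by linarith [h.lt]
      rw [this, abs_of_nonneg (mul_nonneg (sq_nonneg _) h6)]
      nlinarith [sq_nonneg (u x), h.lt]
    rw [abs_mul]
    nlinarith [hf1 x, abs_nonneg (f x), abs_nonneg (u x ^ 2 + u x ^ 3 / 3)]
  have : ∫ θ in (0 : ℝ)..(2 * π), u θ * f θ =
      -∫ θ in (0 : ℝ)..(2 * π), f θ * (u θ ^ 2 + u θ ^ 3 / 3) := by linarith
  rw [this, abs_neg]
  linarith

/-- If the excess is quadratic in `ε`, the profile cannot concentrate near its extremum. -/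
lemma le_integral_abs (h : IsProfile ε K u p) {A : ℝ} (hA : 1 ≤ A)
    (hE : excess u p 0 (2 * π) ≤ A * ε ^ 2) (hε : 16 * A * ε ≤ 1) :
    ε / (128 * A) ≤ ∫ θ in (0 : ℝ)..(2 * π), |u θ| := by
  have hπ := Real.pi_gt_three
  have hε0 := h.pos
  -- `t` and `L` are chosen so that `t * L` and `4 / t * (A * ε ^ 2)` both equal `ε / 4`: over a
  -- length `L` the profile oscillates by at most `ε / 2`.
  set t := 16 * A * ε with ht
  have ht0 : 0 < t := by positivity
  set L := 1 / (64 * A) with hL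
  have hL0 : 0 < L := by positivity
  have hL1 : L ≤ 1 := by
    rw [hL, div_le_one (by positivity)]; linarith
  have hosc : ∀ a b, 0 ≤ a → a ≤ b → b ≤ 2 * π → b - a ≤ L → |u b - u a| ≤ ε / 2 := by
    intro a b ha hab hb hbL
    have i1 : IntervalIntegrable (fun θ => t + 4 / t * (√((1 + u θ) ^ 2 + p θ ^ 2) - (1 + u θ)))
        volume a b := intervalIntegrable_const.add ((h.intervalIntegrable_excess a b).const_mul _)
    calc |u b - u a| = |∫ θ in a..b, p θ| := by rw [h.primitive]
      _ ≤ ∫ θ in a..b, |p θ| := intervalIntegral.abs_integral_le_integral_abs hab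
      _ ≤ ∫ θ in a..b, (t + 4 / t * (√((1 + u θ) ^ 2 + p θ ^ 2) - (1 + u θ))) :=
          intervalIntegral.integral_mono_on hab (h.intervalIntegrable_deriv a b).abs i1
            fun x _ => abs_le_add_sqrt_sub _ (h.one_add_nonneg x) (h.two_mul_one_add_le x) ht0 hε
      _ = t * (b - a) + 4 / t * excess u p a b := by
          rw [intervalIntegral.integral_add intervalIntegrable_const
            ((h.intervalIntegrable_excess a b).const_mul _), intervalIntegral.integral_const,
            smul_eq_mul, intervalIntegral.integral_const_mul, excess, mul_comm t]
      _ ≤ t * L + 4 / t * (A * ε ^ 2) := by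
          have := (h.excess_mono ha hab hb).trans hE
          gcongr
      _ = ε / 2 := by
          rw [ht, hL]; field_simp; norm_num
  have hlow : ∀ a b, 0 ≤ a → a ≤ b → b ≤ 2 * π → b - a = L → (∀ x ∈ Icc a b, ε / 2 ≤ |u x|) →
      ε / (128 * A) ≤ ∫ θ in (0 : ℝ)..(2 * π), |u θ| := by
    intro a b ha hab hb hbL hx
    calc ε / (128 * A) = ∫ θ in a..b, ε / 2 := by
          rw [intervalIntegral.integral_const, hbL, hL, smul_eq_mul]; field_simp; norm_num
      _ ≤ ∫ θ in a..b, |u θ| :=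
          intervalIntegral.integral_mono_on hab intervalIntegrable_const
            (h.cont.abs.intervalIntegrable _ _) hx
      _ ≤ _ := intervalIntegral.integral_mono_interval ha hab hb
            (Eventually.of_forall fun _ => abs_nonneg _) (h.cont.abs.intervalIntegrable _ _)
  obtain ⟨x₀, hx₀, hux₀⟩ := h.attained
  -- The interval of length `L ≤ 1 < π` is laid on the side of the extremum where it stays inside
  -- `[0, 2π]`.
  rcases le_total x₀ π with hle | hle
  · refine hlow x₀ (x₀ + L) hx₀.1 (by linarith) (by linarith) (by ring) fun x hx => ?_
    have h1 := hosc x₀ x hx₀.1 hx.1 (by linarith [hx.2]) (by linarith [hx.2])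
    have h2 := abs_sub_abs_le_abs_sub (u x₀) (u x)
    rw [abs_sub_comm] at h2
    linarith
  · refine hlow (x₀ - L) x₀ (by linarith) (by linarith) hx₀.2 (by ring) fun x hx => ?_
    have h1 := hosc x x₀ (by linarith [hx.1]) hx.2 hx₀.2 (by linarith [hx.1])
    have h2 := abs_sub_abs_le_abs_sub (u x₀) (u x)
    linarith

end IsProfile

/-! ### Truncation of the slope and the nearby competitor. -/

/-- The slope truncated to `0` where it exceeds `δ`. -/
def truncSlope (δ : ℝ) (p : ℝ → ℝ) : ℝ → ℝ := {x | |p x| ≤ δ}.indicator p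

lemma measurable_truncSlope {p : ℝ → ℝ} (hp : Measurable p) (δ : ℝ) :
    Measurable (truncSlope δ p) :=
  hp.indicator (measurableSet_le hp.abs measurable_const)

lemma abs_truncSlope_le {δ : ℝ} (hδ : 0 ≤ δ) (p : ℝ → ℝ) (x : ℝ) : |truncSlope δ p x| ≤ δ := by
  unfold truncSlope
  by_cases hx : |p x| ≤ δ
  · rwa [indicator_of_mem (by exact hx)]
  · rw [indicator_of_notMem (by exact hx)]; simpa

namespace IsProfile

variable {ε K : ℝ} {u p : ℝ → ℝ}

lemma abs_sub_truncSlope_le (h : IsProfile ε K u p) (δ x : ℝ) :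
    |p x - truncSlope δ p x| ≤ K := by
  unfold truncSlope
  have hK : 0 ≤ K := (abs_nonneg _).trans (h.bound_deriv 0)
  by_cases hx : |p x| ≤ δ
  · rw [indicator_of_mem (by exact hx)]; simpa
  · rw [indicator_of_notMem (by exact hx), sub_zero]; exact h.bound_deriv x

lemma intervalIntegrable_sub_truncSlope (h : IsProfile ε K u p) (δ a b : ℝ) :
    IntervalIntegrable (fun θ => p θ - truncSlope δ p θ) volume a b :=
  intervalIntegrable_of_bound (h.meas.sub (measurable_truncSlope h.meas δ))
    (h.abs_sub_truncSlope_le δ) a b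

/-- The factor tends to `2` as `ε` and `δ` vanish, matching `√(1 + p²) - 1 ≈ p² / 2`; this sharpness
yields the constant `π / 4`. -/
lemma integral_truncSlope_sq_le (h : IsProfile ε K u p) {δ : ℝ} (hδ : 0 ≤ δ) :
    ∫ θ in (0 : ℝ)..(2 * π), truncSlope δ p θ ^ 2 ≤
      (2 + 2 * ε + δ) * excess u p 0 (2 * π) := by
  rw [excess, ← intervalIntegral.integral_const_mul]
  refine intervalIntegral.integral_mono_on Real.two_pi_pos.le
    (intervalIntegrable_of_bound (C := δ ^ 2) ((measurable_truncSlope h.meas δ).pow_const 2)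
      (fun x => ?_) _ _) ((h.intervalIntegrable_excess _ _).const_mul _) fun x _ => ?_
  · rw [abs_pow]
    exact pow_le_pow_left₀ (abs_nonneg _) (abs_truncSlope_le hδ p x) 2
  · have h0 := h.excess_density_nonneg x
    have hε := h.pos
    by_cases hx : |p x| ≤ δ
    · rw [truncSlope, indicator_of_mem (by exact hx)]
      refine (sq_le_mul_sqrt_sub (h.one_add_nonneg x) hx).trans ?_
      have := (abs_le.1 (h.bound x)).2
      gcongr
      linarith
    · rw [truncSlope, indicator_of_notMem (by exact hx), zero_pow two_ne_zero]
      positivity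

/-- For fixed `δ`, an excess of order `ε²` makes the steep part so small in `L¹` that removing it
changes `u` only at second order. -/
lemma integral_abs_sub_truncSlope_le (h : IsProfile ε K u p) {δ : ℝ} (hδ : 0 < δ) (hδ1 : δ ≤ 1) :
    ∫ θ in (0 : ℝ)..(2 * π), |p θ - truncSlope δ p θ| ≤ 4 / δ * excess u p 0 (2 * π) := by
  rw [excess, ← intervalIntegral.integral_const_mul]
  refine intervalIntegral.integral_mono_on Real.two_pi_pos.le
    (h.intervalIntegrable_sub_truncSlope δ _ _).abs
    ((h.intervalIntegrable_excess _ _).const_mul _) fun x _ => ?_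
  have h0 := h.excess_density_nonneg x
  by_cases hx : |p x| ≤ δ
  · rw [truncSlope, indicator_of_mem (by exact hx), sub_self, abs_zero]
    positivity
  · rw [truncSlope, indicator_of_notMem (by exact hx), sub_zero, div_mul_eq_mul_div,
      le_div_iff₀ hδ, mul_comm]
    exact mul_abs_le_sqrt_sub (h.one_add_nonneg x) (h.two_mul_one_add_le x) hδ hδ1
      (le_of_not_ge hx)

/-- A profile whose steep part is small is close to a competitor for `m`. -/
lemma exists_linAdmissible_near (h : IsProfile ε K u p) {δ A : ℝ} (hδ : 0 ≤ δ)
    (hA : ∫ θ in (0 : ℝ)..(2 * π), |p θ - truncSlope δ p θ| ≤ A * ε ^ 2) :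
    ∃ w q : ℝ → ℝ, Continuous w ∧ Measurable q ∧
      (∀ x ∈ Icc 0 (2 * π), |w x - u x| ≤ (9 + 12 * A) * ε ^ 2) ∧
      (∀ x, |q x - truncSlope δ p x| ≤ (9 + 12 * A) * ε ^ 2) ∧
      ((∃ x ∈ Icc 0 (2 * π), w x ≠ 0) → LinAdmissible w q) := by
  have hπ := Real.pi_gt_three
  have hpi := Real.two_pi_pos
  set g := truncSlope δ p with hg
  have hgm : Measurable g := measurable_truncSlope h.meas δ
  have hgi : ∀ a b, IntervalIntegrable g volume a b :=
    intervalIntegrable_of_bound hgm (abs_truncSlope_le hδ p)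
  set S := ∫ θ in (0 : ℝ)..(2 * π), |p θ - g θ| with hS
  have hSi : ∀ x ∈ Icc 0 (2 * π), |∫ θ in (0 : ℝ)..x, (p θ - g θ)| ≤ S := fun x hx =>
    (intervalIntegral.abs_integral_le_integral_abs hx.1).trans
      (intervalIntegral.integral_mono_interval le_rfl hx.1 hx.2
        (Eventually.of_forall fun _ => abs_nonneg _)
        (h.intervalIntegrable_sub_truncSlope δ _ _).abs)
  set H := ∫ θ in (0 : ℝ)..(2 * π), (p θ - g θ) with hH
  have hHS : |H| ≤ S := hSi _ (right_mem_Icc.2 hpi.le)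
  have hS0 : 0 ≤ S := (abs_nonneg _).trans hHS
  -- Since `∫p = 0`, the truncated slope has integral `-H`; the added constant restores mean zero,
  -- hence periodicity of the primitive.
  set g₁ : ℝ → ℝ := fun x => g x + H / (2 * π) with hg₁
  have hg₁b : ∀ x, |g₁ x| ≤ δ + |H / (2 * π)| := fun x =>
    (abs_add_le _ _).trans (add_le_add_left (abs_truncSlope_le hδ p x) _)
  have hg₁m : Measurable g₁ := hgm.add_const _
  set v : ℝ → ℝ := fun x => u 0 + ∫ t in (0 : ℝ)..x, g₁ t with hv
  have hvc : Continuous v := (lipschitzWith_primitive hg₁m hg₁b _).continuous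
  have hv0 : v 0 = u 0 := by simp [hv]
  have hvu : ∀ x, v x - u x = x / (2 * π) * H - ∫ θ in (0 : ℝ)..x, (p θ - g θ) := by
    intro x
    rw [hv, intervalIntegral.integral_sub (h.intervalIntegrable_deriv _ _) (hgi _ _), h.primitive]
    simp only [hg₁]
    rw [intervalIntegral.integral_add (hgi _ _) intervalIntegrable_const,
      intervalIntegral.integral_const, smul_eq_mul]
    ring
  have hper : v 0 = v (2 * π) := by
    have := hvu (2 * π)
    rw [div_self hpi.ne', one_mul, ← hH, sub_self] at this
    rw [hv0, h.periodic]; linarith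
  have hvη : ∀ x ∈ Icc 0 (2 * π), |v x - u x| ≤ 2 * S := by
    intro x hx
    rw [hvu x]
    have h1 : |x / (2 * π) * H| ≤ S := by
      rw [abs_mul, abs_of_nonneg (div_nonneg hx.1 hpi.le)]
      exact (mul_le_of_le_one_left (abs_nonneg _) ((div_le_one hpi).2 hx.2)).trans hHS
    exact (abs_sub _ _).trans (by linarith [hSi x hx])
  have hmul : ∀ f : ℝ → ℝ, Continuous f → (∀ x, |f x| ≤ 1) →
      |∫ θ in (0 : ℝ)..(2 * π), v θ * f θ| ≤
        |∫ θ in (0 : ℝ)..(2 * π), u θ * f θ| + 4 * π * S := by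
    intro f hf hf1
    have hc := h.cont
    have e : ∫ θ in (0 : ℝ)..(2 * π), v θ * f θ = (∫ θ in (0 : ℝ)..(2 * π), u θ * f θ) +
        ∫ θ in (0 : ℝ)..(2 * π), (v θ - u θ) * f θ := by
      rw [← intervalIntegral.integral_add (Continuous.intervalIntegrable (by fun_prop) _ _)
        (Continuous.intervalIntegrable (by fun_prop) _ _)]
      congr 1; ext θ; ring
    rw [e]
    refine (abs_add_le _ _).trans (add_le_add_right ?_ _)
    refine (abs_intervalIntegral_le (C := 2 * S) hpi.le fun x hx => ?_).trans (by linarith)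
    rw [abs_mul]
    exact (mul_le_of_le_one_right (abs_nonneg _) (hf1 x)).trans (hvη x hx)
  set a := (∫ θ in (0 : ℝ)..(2 * π), v θ) / (2 * π) with ha
  set b := (∫ θ in (0 : ℝ)..(2 * π), v θ * Real.cos θ) / π with hb
  set c := (∫ θ in (0 : ℝ)..(2 * π), v θ * Real.sin θ) / π with hc
  have ha' : |a| ≤ ε ^ 2 + 2 * S := by
    have h1 := hmul (fun _ => 1) continuous_const (fun _ => by simp)
    simp only [mul_one] at h1
    rw [h.integral_eq, abs_neg, abs_of_nonneg
      (mul_nonneg one_half_pos.le h.integral_sq_nonneg)] at h1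
    rw [ha, abs_div, abs_of_pos hpi, div_le_iff₀ hpi]
    nlinarith [h.integral_sq_le, sq_nonneg ε]
  have hb' : |b| ≤ 4 * ε ^ 2 + 4 * S := by
    have h1 := hmul _ Real.continuous_cos Real.abs_cos_le_one
    have h2 := h.abs_integral_mul_le Real.continuous_cos Real.abs_cos_le_one (by simp)
      h.barycentre_cos
    rw [hb, abs_div, abs_of_pos Real.pi_pos, div_le_iff₀ Real.pi_pos]
    linarith
  have hc' : |c| ≤ 4 * ε ^ 2 + 4 * S := by
    have h1 := hmul _ Real.continuous_sin Real.abs_sin_le_one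
    have h2 := h.abs_integral_mul_le Real.continuous_sin Real.abs_sin_le_one (by simp)
      h.barycentre_sin
    rw [hc, abs_div, abs_of_pos Real.pi_pos, div_le_iff₀ Real.pi_pos]
    linarith
  have hmul1 : ∀ r s : ℝ, |s| ≤ 1 → |r * s| ≤ |r| := fun r s hs => by
    rw [abs_mul]; exact mul_le_of_le_one_right (abs_nonneg _) hs
  refine ⟨fun θ => v θ - a - b * Real.cos θ - c * Real.sin θ,
    fun θ => g₁ θ + b * Real.sin θ - c * Real.cos θ, by fun_prop, by fun_prop, ?_, ?_, ?_⟩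
  -- The contributions `2S` from `v - u`, `ε² + 2S` from `a`, and `4ε² + 4S` from each of `b`, `c`
  -- add up to `9ε² + 12S`.
  · intro x hx
    have h1 := hvη x hx
    have h2 := hmul1 b _ (Real.abs_cos_le_one x)
    have h3 := hmul1 c _ (Real.abs_sin_le_one x)
    have h4 := abs_le.1 ha'
    rw [abs_le] at h1 h2 h3 ⊢
    dsimp only
    constructor <;> linarith
  · intro x
    have h2 := hmul1 b _ (Real.abs_sin_le_one x)
    have h3 := hmul1 c _ (Real.abs_cos_le_one x)
    have h4 : |H / (2 * π)| ≤ S := by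
      rw [abs_div, abs_of_pos hpi, div_le_iff₀ hpi]
      nlinarith
    simp only [hg₁]
    rw [abs_le] at h2 h3 h4 ⊢
    have h5 := sq_nonneg ε
    constructor <;> linarith
  · intro hne
    refine linAdmissible_sub_harmonics hg₁m hg₁b (fun x => ?_) hper ?_ ?_ ?_ hne
    · rw [hv0]
    · rw [ha]; field_simp
    · rw [hb]; field_simp
    · rw [hc]; field_simp

end IsProfile

/-! ### Comparison of the deficit with the linearized functional. -/

/-- Squares of two small quantities that agree to second order agree to third order. -/
lemma sq_le_sq_add_of_close {M B ε N L W : ℝ} (hB : 0 ≤ B) (hε : 0 < ε) (hε1 : ε < 1 / 24)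
    (hN : 0 ≤ N) (hW : 0 ≤ W) (hNL : |N - L| ≤ π * ε ^ 2) (hN3 : N ≤ 3 * π * ε)
    (hL : L ≤ 2 * π * ε) (hWL : |W - L| ≤ 2 * π * B * ε ^ 2) :
    M * N ^ 2 ≤ M * W ^ 2 + |M| * (π * (2 * B + 5)) ^ 2 * ε ^ 3 := by
  have hπ := Real.pi_pos
  have h1 : |N - W| ≤ π * (2 * B + 5) * ε ^ 2 := by
    have h2 : 0 ≤ π * ε ^ 2 := by positivity
    rw [abs_le] at hNL hWL ⊢
    constructor <;> linarith
  have h2 : |N + W| ≤ π * (2 * B + 5) * ε := by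
    rw [abs_of_nonneg (by linarith)]
    have : 2 * π * B * ε ^ 2 ≤ 2 * π * B * ε := by
      gcongr; nlinarith
    linarith [(abs_le.1 hWL).2]
  have h3 : |N ^ 2 - W ^ 2| ≤ π * (2 * B + 5) * ε ^ 2 * (π * (2 * B + 5) * ε) := by
    rw [show N ^ 2 - W ^ 2 = (N - W) * (N + W) by ring, abs_mul]
    gcongr
  -- `M` may be negative, hence `|M|`.
  have h4 : M * (N ^ 2 - W ^ 2) ≤ |M| * |N ^ 2 - W ^ 2| := by
    rw [← abs_mul]; exact le_abs_self _
  have h5 := mul_le_mul_of_nonneg_left h3 (abs_nonneg M)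
  linarith

/-- Arithmetic of `le_deficit`: `E` is the excess, `F` the energy of the truncated slope, `G`, `V`,
`W` are `∫q²`, `∫w²`, `∫|w|` for the nearby competitor, `U` is `∫u²`, and `N` is half of `∫|(1 + u)²
- 1|`. -/
lemma deficit_le_of_bounds {A B M P δ ε E F G U V W N : ℝ} (hδ : 0 ≤ δ)
    (hδ1 : δ ≤ 1) (hε : 0 < ε) (hε1 : ε < 1 / 24) (hE0 : 0 ≤ E)
    (hE : E ≤ A * ε ^ 2) (hFE : F ≤ (2 + 2 * ε + δ) * E) (hlin : M * W ^ 2 ≤ G - V)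
    (hGF : G ≤ (1 + ε) * F + 4 * π * B ^ 2 * ε ^ 3)
    (hUV : U ≤ V + 2 * π * (2 * B + B ^ 2) * ε ^ 3)
    (hMWN : M * N ^ 2 ≤ M * W ^ 2 + |M| * P ^ 2 * ε ^ 3) :
    1 / 2 * M * N ^ 2 ≤ E - 1 / 2 * U + A * δ * ε ^ 2 +
      (4 * A + 2 * π * B ^ 2 + π * (2 * B + B ^ 2) + 1 / 2 * |M| * P ^ 2) * ε ^ 3 := by
  have hF4 : F ≤ 4 * A * ε ^ 2 := by
    have : (2 + 2 * ε + δ) * E ≤ 4 * E := by gcongr; linarith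
    linarith
  -- With `s = 2ε + δ`, multiplying `F ≤ (2 + s) E` by `2 - s ≥ 0` gives `(2 - s) F ≤ (4 - s²) E ≤
  -- 4E`.
  have hFE' : F / 2 ≤ E + (2 * ε + δ) / 4 * F := by
    have h1 : 0 ≤ 2 - (2 * ε + δ) := by linarith
    have h2 := mul_le_mul_of_nonneg_left hFE h1
    have h3 := mul_nonneg (sq_nonneg (2 * ε + δ)) hE0
    linarith
  have h1 : (2 * ε + δ) / 4 * F ≤ (2 * ε + δ) / 4 * (4 * A * ε ^ 2) := by gcongr
  have h2 : ε * F ≤ ε * (4 * A * ε ^ 2) := by gcongr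
  linarith

namespace IsProfile

variable {ε K : ℝ} {u p : ℝ → ℝ}

/-- Half the area of the symmetric difference is comparable to the `L¹` norm. -/
lemma half_integral_abs_bounds (h : IsProfile ε K u p) :
    let N := 1 / 2 * ∫ θ in (0 : ℝ)..(2 * π), |(1 + u θ) ^ 2 - 1|
    let L := ∫ θ in (0 : ℝ)..(2 * π), |u θ|
    1 / 2 * L ≤ N ∧ |N - L| ≤ π * ε ^ 2 ∧ N ≤ 3 * π * ε ∧ L ≤ 2 * π * ε ∧ 0 < L := by
  intro N L
  have hc := h.cont
  have hpi := Real.two_pi_pos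
  have hε := h.pos
  have hε1 := h.lt
  have e : ∀ x, |(1 + u x) ^ 2 - 1| = |u x| * (2 + u x) := fun x => by
    rw [show (1 + u x) ^ 2 - 1 = u x * (2 + u x) by ring, abs_mul,
      abs_of_nonneg (by linarith [h.one_add_nonneg x] : 0 ≤ 2 + u x)]
  have h1 : L ≤ ∫ θ in (0 : ℝ)..(2 * π), |(1 + u θ) ^ 2 - 1| := by
    refine intervalIntegral.integral_mono_on hpi.le
      (Continuous.intervalIntegrable (by fun_prop) _ _)
      (Continuous.intervalIntegrable (by fun_prop) _ _) fun x _ => ?_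
    rw [e]
    nlinarith [abs_nonneg (u x), h.one_add_nonneg x]
  have h2 : |∫ θ in (0 : ℝ)..(2 * π), (|(1 + u θ) ^ 2 - 1| - 2 * |u θ|)| ≤
      ε ^ 2 * (2 * π - 0) := by
    refine abs_intervalIntegral_le hpi.le fun x _ => ?_
    rw [e, show |u x| * (2 + u x) - 2 * |u x| = |u x| * u x by ring, abs_mul, abs_abs,
      ← pow_two, sq_abs]
    exact h.sq_bound x
  rw [intervalIntegral.integral_sub (Continuous.intervalIntegrable (by fun_prop) _ _)
    (Continuous.intervalIntegrable (by fun_prop) _ _), intervalIntegral.integral_const_mul] at h2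
  have h3 : |L| ≤ ε * (2 * π - 0) := abs_intervalIntegral_le hpi.le fun x _ => by
    rw [abs_abs]; exact h.bound x
  have h4 : |N - L| ≤ π * ε ^ 2 := by
    rw [abs_le] at h2 ⊢
    simp only [N, L]
    constructor <;> linarith
  have h5 : L ≤ 2 * π * ε := by linarith [le_abs_self L]
  refine ⟨by simp only [N]; linarith, h4, ?_, h5, ?_⟩
  · have : π * ε ^ 2 ≤ π * ε := by
      have := Real.pi_pos
      gcongr; nlinarith
    linarith [(abs_le.1 h4).2]
  · obtain ⟨x, hx, hux⟩ := h.attained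
    exact intervalIntegral.integral_pos hpi hc.abs.continuousOn (fun _ _ => abs_nonneg _)
      ⟨x, hx, by rw [hux]; exact hε⟩

/-- The deficit dominates the linearized functional up to errors of higher order. -/
lemma le_deficit (h : IsProfile ε K u p) {A M δ B : ℝ} (hA : 1 ≤ A) (hδ : 0 < δ) (hδ1 : δ ≤ 1)
    (hM : ∀ w q, LinAdmissible w q → M ≤ linQuotient w q)
    (hE : excess u p 0 (2 * π) ≤ A * ε ^ 2) (hε : 16 * A * ε ≤ 1)
    (hB : B = 9 + 12 * (4 / δ * A)) (hBε : 2 * π * B * ε < 1 / (128 * A)) :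
    1 / 2 * M * (1 / 2 * ∫ θ in (0 : ℝ)..(2 * π), |(1 + u θ) ^ 2 - 1|) ^ 2 ≤
      excess u p 0 (2 * π) - 1 / 2 * (∫ θ in (0 : ℝ)..(2 * π), u θ ^ 2) + A * δ * ε ^ 2 +
      (4 * A + 2 * π * B ^ 2 + π * (2 * B + B ^ 2) +
        1 / 2 * |M| * (π * (2 * B + 5)) ^ 2) * ε ^ 3 := by
  have hpi := Real.two_pi_pos
  have hπ := Real.pi_pos
  have hε0 := h.pos
  have hε1 := h.lt
  have hB0 : 0 ≤ B := by rw [hB]; positivity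
  have hsteep : ∫ θ in (0 : ℝ)..(2 * π), |p θ - truncSlope δ p θ| ≤ (4 / δ * A) * ε ^ 2 := by
    refine (h.integral_abs_sub_truncSlope_le hδ hδ1).trans ?_
    rw [mul_assoc]; gcongr
  obtain ⟨w, q, hwc, hqm, hwu, hqg, hadm⟩ := h.exists_linAdmissible_near hδ.le hsteep
  rw [← hB] at hwu hqg
  obtain ⟨-, hNL, hN3, hL3, -⟩ := h.half_integral_abs_bounds
  have hlow := h.le_integral_abs hA hE hε
  have hN0 : 0 ≤ 1 / 2 * ∫ θ in (0 : ℝ)..(2 * π), |(1 + u θ) ^ 2 - 1| :=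
    mul_nonneg one_half_pos.le (intervalIntegral.integral_nonneg hpi.le fun _ _ => abs_nonneg _)
  set N := 1 / 2 * ∫ θ in (0 : ℝ)..(2 * π), |(1 + u θ) ^ 2 - 1| with hN
  set L := ∫ θ in (0 : ℝ)..(2 * π), |u θ| with hL
  set W := ∫ θ in (0 : ℝ)..(2 * π), |w θ| with hW
  set E := excess u p 0 (2 * π) with hEdef
  set F := ∫ θ in (0 : ℝ)..(2 * π), truncSlope δ p θ ^ 2 with hF
  set G := ∫ θ in (0 : ℝ)..(2 * π), q θ ^ 2 with hG
  set U := ∫ θ in (0 : ℝ)..(2 * π), u θ ^ 2 with hU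
  set V := ∫ θ in (0 : ℝ)..(2 * π), w θ ^ 2 with hV
  have hE0 : 0 ≤ E :=
    intervalIntegral.integral_nonneg hpi.le fun x _ => h.excess_density_nonneg x
  have hFE : F ≤ (2 + 2 * ε + δ) * E := h.integral_truncSlope_sq_le hδ.le
  have hc := h.cont
  have hWL : |W - L| ≤ 2 * π * B * ε ^ 2 := by
    rw [hW, hL, ← intervalIntegral.integral_sub (hwc.abs.intervalIntegrable _ _)
      (hc.abs.intervalIntegrable _ _)]
    refine (abs_intervalIntegral_le hpi.le fun x hx =>
      (abs_abs_sub_abs_le_abs_sub _ _).trans (hwu x hx)).trans (by linarith)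
  -- Non-concentration makes `∫|u|` exceed the `O(ε²)` perturbation, so the competitor is nonzero.
  have hW0 : 0 < W := by
    have h1 := (abs_le.1 hWL).1
    have h2 : 2 * π * B * ε ^ 2 < ε / (128 * A) := by
      calc 2 * π * B * ε ^ 2 = (2 * π * B * ε) * ε := by ring
        _ < 1 / (128 * A) * ε := by gcongr
        _ = ε / (128 * A) := by ring
    linarith
  have hwne : ∃ x ∈ Icc 0 (2 * π), w x ≠ 0 := by
    by_contra! h0
    refine hW0.ne' ?_
    rw [hW, intervalIntegral.integral_congr (g := fun _ => (0 : ℝ)) fun x hx => ?_]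
    · simp
    · rw [uIcc_of_le hpi.le] at hx
      simp [h0 x hx]
  have hqb : ∀ x, |q x| ≤ δ + B * ε ^ 2 := fun x => by
    have h1 := abs_truncSlope_le hδ.le p x
    have h2 := hqg x
    rw [abs_le] at h1 h2 ⊢
    constructor <;> linarith
  have hqi : IntervalIntegrable (fun θ => q θ ^ 2) volume 0 (2 * π) :=
    intervalIntegrable_of_bound (hqm.pow_const 2) (C := (δ + B * ε ^ 2) ^ 2)
      (fun x => by rw [abs_pow]; exact pow_le_pow_left₀ (abs_nonneg _) (hqb x) 2) _ _
  have hgi : IntervalIntegrable (fun θ => truncSlope δ p θ ^ 2) volume 0 (2 * π) :=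
    intervalIntegrable_of_bound ((measurable_truncSlope h.meas δ).pow_const 2) (C := δ ^ 2)
      (fun x => by
        rw [abs_pow]; exact pow_le_pow_left₀ (abs_nonneg _) (abs_truncSlope_le hδ.le p x) 2) _ _
  have hlin : M * W ^ 2 ≤ G - V := by
    have h1 := hM w q (hadm hwne)
    rw [linQuotient, le_div_iff₀ (by positivity), intervalIntegral.integral_sub hqi
      (Continuous.intervalIntegrable (by fun_prop) _ _)] at h1
    exact h1
  have hGF : G ≤ (1 + ε) * F + 4 * π * B ^ 2 * ε ^ 3 := by
    calc G ≤ ∫ θ in (0 : ℝ)..(2 * π), ((1 + ε) * truncSlope δ p θ ^ 2 + 2 * B ^ 2 * ε ^ 3) := by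
          refine intervalIntegral.integral_mono_on hpi.le hqi
            ((hgi.const_mul _).add intervalIntegrable_const) fun x _ => ?_
          have h1 := hqg x
          set g := truncSlope δ p x
          have h2 : |q x| ≤ |g| + B * ε ^ 2 := by
            linarith [abs_sub_abs_le_abs_sub (q x) g]
          have h3 : q x ^ 2 ≤ (|g| + B * ε ^ 2) ^ 2 := by
            rw [← sq_abs]; exact pow_le_pow_left₀ (abs_nonneg _) h2 2
          -- Weighted Young inequality: `2|g|Bε² ≤ εg² + B²ε³`.
          have h4 : 0 ≤ ε * (|g| - B * ε) ^ 2 := by positivity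
          have h5 : B ^ 2 * ε ^ 3 * ε ≤ B ^ 2 * ε ^ 3 * 1 := by gcongr; linarith
          nlinarith [sq_abs g]
      _ = (1 + ε) * F + 4 * π * B ^ 2 * ε ^ 3 := by
          rw [intervalIntegral.integral_add (hgi.const_mul _) intervalIntegrable_const,
            intervalIntegral.integral_const_mul, intervalIntegral.integral_const, smul_eq_mul, hF]
          ring
  have hUV : U ≤ V + 2 * π * (2 * B + B ^ 2) * ε ^ 3 := by
    have h0 : |∫ θ in (0 : ℝ)..(2 * π), (u θ ^ 2 - w θ ^ 2)| ≤
        (2 * B + B ^ 2) * ε ^ 3 * (2 * π - 0) := by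
      refine abs_intervalIntegral_le hpi.le fun x hx => ?_
      have h1 := hwu x hx
      have h2 : |u x + w x| ≤ 2 * ε + B * ε ^ 2 := by
        have h3 := h.bound x
        rw [abs_le] at h1 h3 ⊢
        constructor <;> linarith
      rw [show u x ^ 2 - w x ^ 2 = (u x - w x) * (u x + w x) by ring, abs_mul, abs_sub_comm]
      have h3 : |w x - u x| * |u x + w x| ≤ B * ε ^ 2 * (2 * ε + B * ε ^ 2) := by gcongr
      have h5 : B ^ 2 * ε ^ 3 * ε ≤ B ^ 2 * ε ^ 3 * 1 := by gcongr; linarith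
      nlinarith
    rw [intervalIntegral.integral_sub (Continuous.intervalIntegrable (by fun_prop) _ _)
      (Continuous.intervalIntegrable (by fun_prop) _ _)] at h0
    linarith [le_abs_self (U - V)]
  have hMWN : M * N ^ 2 ≤ M * W ^ 2 + |M| * (π * (2 * B + 5)) ^ 2 * ε ^ 3 :=
    sq_le_sq_add_of_close hB0 hε0 hε1 hN0 hW0.le hNL hN3 hL3 hWL
  exact deficit_le_of_bounds hδ.le hδ1 hε0 hε1 hE0 hE hFE hlin hGF hUV hMWN

end IsProfile

/-! ### From admissible functions to profiles, and the limit. -/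

/-- Extending an admissible function by constants outside `[0, 2π]` gives a profile. -/
lemma Admissible.exists_isProfile {ε : ℝ} {u : ℝ → ℝ} (h : Admissible ε u) (hε : 0 < ε)
    (hε1 : ε < 1 / 24) : ∃ (v : ℝ → ℝ) (K : ℝ), IsProfile ε K v (deriv v) ∧ J v = J u := by
  have hpi := Real.two_pi_pos
  obtain ⟨K, hK⟩ := h.lipschitz
  set v : ℝ → ℝ := fun x => u (projIcc 0 (2 * π) hpi.le x) with hv
  have hvL : LipschitzWith K v := by
    have := hK.to_restrict.comp (LipschitzWith.projIcc hpi.le)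
    rwa [mul_one] at this
  have hvu : ∀ x ∈ Icc 0 (2 * π), v x = u x := fun x hx => by
    simp only [hv]; rw [projIcc_of_mem hpi.le hx]
  have hd : ∀ x ∈ Ioo 0 (2 * π), deriv v x = deriv u x := fun x hx =>
    Filter.EventuallyEq.deriv_eq <| by
      filter_upwards [Ioo_mem_nhds hx.1 hx.2] with y hy using hvu y (Ioo_subset_Icc_self hy)
  have hvc := hvL.continuous
  have hnorm : eLpNormEssSup v (volume.restrict (Ioo 0 (2 * π))) = ENNReal.ofReal ε := by
    rw [← h.norm_eq, eLpNorm_exponent_top]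
    refine eLpNormEssSup_congr_ae ?_
    filter_upwards [ae_restrict_mem measurableSet_Ioo] with x hx
    exact hvu x (Ioo_subset_Icc_self hx)
  have hbound : ∀ x ∈ Icc 0 (2 * π), |v x| ≤ ε := by
    have hae : ∀ᵐ x ∂(volume.restrict (Ioo 0 (2 * π))), |v x| ≤ ε := by
      filter_upwards [ae_le_eLpNormEssSup (f := v) (μ := volume.restrict (Ioo 0 (2 * π)))]
        with x hx
      rw [hnorm, Real.enorm_eq_ofReal_abs] at hx
      exact (ENNReal.ofReal_le_ofReal_iff hε.le).1 hx
    intro x hx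
    by_contra! hlt
    -- By continuity, one violation of the bound would produce a nonempty open set of violations, of
    -- positive measure.
    have hO : IsOpen {y | ε < |v y|} := isOpen_lt continuous_const hvc.abs
    rw [← closure_Ioo hpi.ne] at hx
    have hne := mem_closure_iff.1 hx _ hO hlt
    have hpos := (hO.inter isOpen_Ioo).measure_pos volume hne
    rw [ae_iff] at hae
    simp only [not_le] at hae
    rw [Measure.restrict_apply hO.measurableSet] at hae
    exact hpos.ne' hae
  have hmem : ∀ x, (projIcc 0 (2 * π) hpi.le x : ℝ) ∈ Icc 0 (2 * π) := fun x =>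
    (projIcc 0 (2 * π) hpi.le x).2
  have hcongr : ∀ F : ℝ → ℝ → ℝ,
      ∫ θ in (0 : ℝ)..(2 * π), F θ (v θ) = ∫ θ in (0 : ℝ)..(2 * π), F θ (u θ) := fun F =>
    intervalIntegral.integral_congr fun x hx => by
      rw [uIcc_of_le hpi.le] at hx
      simp only [hvu x hx]
  refine ⟨v, K, ⟨hε, hε1, hvc, measurable_deriv v, fun x => ?_,
    fun x => norm_deriv_le_of_lipschitz hvL, fun a b => ?_, ?_, ?_, ?_, ?_, ?_⟩, ?_⟩
  · have := hbound _ (hmem x)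
    rwa [hvu _ (hmem x)] at this
  · exact (hvL.lipschitzOnWith (s := uIcc a b)).absolutelyContinuousOnInterval.integral_deriv_eq_sub
  · rw [hvu _ (left_mem_Icc.2 hpi.le), hvu _ (right_mem_Icc.2 hpi.le), h.periodic]
  · rw [hcongr fun _ y => (1 + y) ^ 2]
    have := h.area
    rw [one_div, inv_mul_eq_iff_eq_mul₀ hpi.ne', mul_one] at this
    exact this
  · rw [hcongr fun θ y => Real.cos θ * (1 + y) ^ 3]; exact h.barycentre_cos
  · rw [hcongr fun θ y => Real.sin θ * (1 + y) ^ 3]; exact h.barycentre_sin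
  · obtain ⟨x, hx, hmax⟩ := isCompact_Icc.exists_isMaxOn (nonempty_Icc.2 hpi.le)
      (hvc.abs.continuousOn (s := Icc 0 (2 * π)))
    refine ⟨x, hx, le_antisymm (hbound x hx) ?_⟩
    rw [← ENNReal.ofReal_le_ofReal_iff (abs_nonneg _), ← hnorm]
    refine eLpNormEssSup_le_of_ae_bound ?_
    filter_upwards [ae_restrict_mem measurableSet_Ioo] with y hy
    exact hmax (Ioo_subset_Icc_self hy)
  · unfold J
    rw [hcongr fun _ y => |(1 + y) ^ 2 - 1|]
    congr 2
    refine intervalIntegral.integral_congr_Ioo_of_le hpi.le fun x hx => ?_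
    simp only [hd x hx, hvu x (Ioo_subset_Icc_self hx)]

/-- A lower bound for the linearized quotient is asymptotically a lower bound for `J`. -/
lemma eventually_le_J {C M : ℝ} (hM : ∀ w q, LinAdmissible w q → M ≤ linQuotient w q)
    (hC : C < π / 4 * M) :
    ∀ᶠ ε in 𝓝[Ioo 0 (1 / 24)] (0 : ℝ), ∀ u, Admissible ε u → C ≤ J u := by
  have hπ := Real.pi_pos
  have hπ3 := Real.pi_gt_three
  -- If `J < C`, then `N ≤ 3πε` bounds the deficit by `18π|C|ε²`; the remaining `π` pays for `½∫u² ≤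
  -- πε²`.
  set A := 18 * π * |C| + π with hAdef
  have hA : 1 ≤ A := by
    have : 0 ≤ 18 * π * |C| := by positivity
    linarith
  set γ := π / 4 * M - C with hγ
  have hγ0 : 0 < γ := sub_pos.2 hC
  -- `Q / 4` is `π / 2` times the constant in `ε² ≤ (256A)² N²`. Thus `δ`, and then `ε`, are chosen
  -- to make the total error a fraction of the gap `γ`.
  set Q := 2 * π * (256 * A) ^ 2 with hQ
  have hQ0 : 0 < Q := by positivity
  set δ := min 1 (γ / (4 * Q * A)) with hδdef
  have hδ : 0 < δ := lt_min one_pos (by positivity)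
  have hδ1 : δ ≤ 1 := min_le_left _ _
  have hδγ : Q * (A * δ) ≤ γ / 4 := by
    have h1 : δ ≤ γ / (4 * Q * A) := min_le_right _ _
    rw [le_div_iff₀ (by positivity)] at h1
    linarith
  set B := 9 + 12 * (4 / δ * A) with hB
  set R := 4 * A + 2 * π * B ^ 2 + π * (2 * B + B ^ 2) +
    1 / 2 * |M| * (π * (2 * B + 5)) ^ 2 with hR
  have hsmall : ∀ k r : ℝ, 0 < r → ∀ᶠ ε in 𝓝[Ioo 0 (1 / 24)] (0 : ℝ), k * ε < r := by
    intro k r hr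
    have : Tendsto (fun ε : ℝ => k * ε) (𝓝 0) (𝓝 (k * 0)) :=
      (continuous_const.mul continuous_id).tendsto 0
    rw [mul_zero] at this
    exact (this.mono_left nhdsWithin_le_nhds).eventually_lt_const hr
  filter_upwards [hsmall (16 * A) 1 one_pos,
    hsmall (2 * π * B) (1 / (128 * A)) (by positivity), hsmall (Q * R) (γ / 4) (by positivity),
    self_mem_nhdsWithin] with ε he1 he2 he3 hε u hu
  obtain ⟨v, K, hv, hJ⟩ := hu.exists_isProfile hε.1 hε.2
  rw [← hJ]
  by_contra! hlt
  obtain ⟨hLN, -, hN3, -, hL0⟩ := hv.half_integral_abs_bounds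
  rw [J, hv.deficit_eq] at hlt
  have hmain := fun hE => hv.le_deficit hA hδ hδ1 hM hE he1.le hB he2
  have hlow := fun hE => hv.le_integral_abs hA hE he1.le
  have hU := hv.integral_sq_le
  set N := 1 / 2 * ∫ θ in (0 : ℝ)..(2 * π), |(1 + v θ) ^ 2 - 1| with hN
  have hN0 : 0 < N := by linarith
  rw [div_lt_iff₀ (by positivity)] at hlt
  have hE : excess v (deriv v) 0 (2 * π) ≤ A * ε ^ 2 := by
    have h1 : C * N ^ 2 ≤ |C| * (3 * π * ε) ^ 2 := by
      have := le_abs_self C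
      gcongr
    have h2 : π / 2 * (excess v (deriv v) 0 (2 * π) -
        1 / 2 * ∫ θ in (0 : ℝ)..(2 * π), v θ ^ 2) < π / 2 * (18 * π * |C| * ε ^ 2) := by
      linarith
    have h3 := lt_of_mul_lt_mul_left h2 (by positivity)
    rw [hAdef]
    linarith
  have h1 := hmain hE
  rw [← hR] at h1
  have h2 := hlow hE
  have h3 : ε / (256 * A) ≤ N := by
    have : ε / (256 * A) = 1 / 2 * (ε / (128 * A)) := by
      field_simp; ring
    linarith
  have h4 : ε ^ 2 ≤ N ^ 2 * (256 * A) ^ 2 := by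
    rw [div_le_iff₀ (by positivity)] at h3
    rw [← mul_pow]
    exact pow_le_pow_left₀ hε.1.le h3 2
  have h5 : γ * N ^ 2 < π / 2 * ((A * δ + R * ε) * ε ^ 2) := by
    have := mul_le_mul_of_nonneg_left h1 (by positivity : 0 ≤ π / 2)
    rw [hγ]
    linarith
  have h6 : γ * ε ^ 2 ≤ γ * (N ^ 2 * (256 * A) ^ 2) := by gcongr
  have h7 : γ * N ^ 2 * (256 * A) ^ 2 <
      π / 2 * ((A * δ + R * ε) * ε ^ 2) * (256 * A) ^ 2 := by gcongr
  have h8 : γ * ε ^ 2 < (Q * (A * δ) + Q * R * ε) / 4 * ε ^ 2 := by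
    rw [hQ]; linarith
  have h9 := lt_of_mul_lt_mul_right h8 (sq_nonneg ε)
  linarith

end BarycentricAsymmetry

end

theorem proposition4p3 :
    ((π / 4 : ℝ) : EReal) * BarycentricAsymmetry.mLin ≤
      liminf (fun ε : ℝ => BarycentricAsymmetry.mEps ε) (𝓝[Ioo 0 (1 / 24)] (0 : ℝ)) := by
  have hπ : 0 < π / 4 := by have := Real.pi_pos; positivity
  rw [← EReal.ge_of_forall_gt_iff_ge]
  intro C hC
  -- `mLin` is an extended real: `⊥` is excluded by `hC`, a finite value serves as `M`, and for `⊤`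
  -- any large enough real does.
  obtain ⟨M, hM, hCM⟩ : ∃ M : ℝ, (M : EReal) ≤ BarycentricAsymmetry.mLin ∧ C < π / 4 * M := by
    induction hm : BarycentricAsymmetry.mLin using EReal.rec with
    | bot =>
      rw [hm, EReal.coe_mul_bot_of_pos hπ] at hC
      exact absurd hC not_lt_bot
    | coe x =>
      rw [hm] at hC
      exact ⟨x, le_rfl, by exact_mod_cast hC⟩
    | top =>
      refine ⟨(C + 1) / (π / 4), le_top, ?_⟩
      rw [mul_div_cancel₀ _ hπ.ne']
      linarith
  refine le_liminf_of_le (by isBoundedDefault) ?_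
  have hlin : ∀ w q, BarycentricAsymmetry.LinAdmissible w q →
      M ≤ BarycentricAsymmetry.linQuotient w q := fun w q h => by
    exact_mod_cast hM.trans (sInf_le ⟨w, q, h, rfl⟩)
  filter_upwards [BarycentricAsymmetry.eventually_le_J hlin hCM] with ε h
  refine le_sInf ?_
  rintro _ ⟨u, hu, rfl⟩
  exact_mod_cast h u hu
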